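/- Let $k\ge 1$ be an integer. For $\alpha\in\mathbb R$ let $F_\alpha$ be the (complex, algebraic) Fock module of charge $\alpha$: it has a highest weight vector $|\alpha\rangle$ and operators $a_n$ ($n\in\mathbb Z$) with $[a_n,a_m]=n\,\delta_{n+m,0}$, $a_0=\alpha$, $a_n|\alpha\rangle=0$ for $n>0$, and it has as a basis the monomials in $a_{-1},a_{-2},\dots$ applied to $|\alpha\rangle$. Consider the set of charges $\Lambda=\{\alpha_{nm}: n,m\in\mathbb Z\}$, $\alpha_{nm}=n\sqrt{2k}+\frac{m}{\sqrt{2k}}$, and the chiral space $$H=\bigoplus_{\alpha\in\Lambda}F_\alpha$$ (algebraic direct sum, each charge of the set $\Lambda$ being taken once). On $H$ consider the modes $J^0_n=\frac{1}{\sqrt{2k}}\,a_n$ of the $U(1)$ current $J^0(z)=\frac{1}{\sqrt{2k}}\,i\partial\phi(z)=\sum_n J^0_n z^{-n-1}$, and the modes $J^\pm_n$ of the spin-$k$ currents $$J^{\pm}(z)=\,:\!e^{\pm i\sqrt{2k}\,\phi(z)}\!:\;=\sum_{n\in\mathbb Z}J^\pm_n z^{-n-k},\qquad :\!e^{i\beta\phi(z)}\!:\;=e^{\beta\sum_{n>0}\frac{a_{-n}}{n}z^n}\,e^{-\beta\sum_{n>0}\frac{a_n}{n}z^{-n}}\,T_\beta\,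 z^{\beta a_0},$$ where $T_\beta:F_\alpha\to F_{\alpha+\beta}$ is the linear isomorphism that sends $|\alpha\rangle$ to $|\alpha+\beta\rangle$ and commutes with all $a_n$, $n\neq0$. Let $\mathcal A$ be the algebra of operators on $H$ generated by all $J^+_n$, $J^-_n$, $J^0_n$, $n\in\mathbb Z$. Then $$H=\bigoplus_{m=0}^{2k-1}\mathcal H_m,\qquad \mathcal H_m=\bigoplus_{n\in\mathbb Z}F_{\frac{m}{\sqrt{2k}}+n\sqrt{2k}},$$ and each $\mathcal H_m$ is an $\mathcal A$-submodule of $H$ that is irreducible as an $\mathcal A$-module. -/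

import Mathlib

noncomputable section

namespace TorusModel

/-- The (algebraic) Fock module `F_α` of charge `α`. The polynomial `1` is the highest weight
vector `|α⟩`, and the monomial `∏ X_j ^ e_j` is the state `∏ (a_{-(j+1)}) ^ e_j |α⟩`. -/
abbrev Fock (_α : ℝ) : Type := MvPolynomial ℕ ℂ

/-- The oscillator modes `a_n`, `n ∈ ℤ`, on `F_α`, with `[a_n, a_m] = n δ_{n+m,0}`:
`a_0` is the charge, `a_{j+1} = (j+1) ∂/∂X_j`, and `a_{-(j+1)}` is multiplication by `X_j`. -/
def oscillator (α : ℝ) : ℤ → Module.End ℂ (Fock α)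
  | Int.ofNat 0 => (α : ℂ) • LinearMap.id
  | Int.ofNat (j + 1) => ((j + 1 : ℕ) : ℂ) • (MvPolynomial.pderiv j).toLinearMap
  | Int.negSucc j => LinearMap.mulLeft ℂ (MvPolynomial.X j)

/-- The coefficient of `w ^ N` in `exp (∑_{i > 0} t_i w ^ i) = ∑_l (∑_{i > 0} t_i w ^ i) ^ l / l!`:
the `l`-th power contributes the products `t_{i_1} ⋯ t_{i_l}` with `i_1 + ⋯ + i_l = N`. -/
def expCoeff {A : Type*} [Ring A] [Algebra ℂ A] (t : ℕ → A) (N : ℕ) : A :=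
  ∑ c : Composition N, ((c.length.factorial : ℂ)⁻¹) • (c.blocks.map t).prod

/-- The coefficient of `z ^ N` in `exp (β ∑_{n > 0} (a_{-n} / n) z ^ n)`. -/
def creationCoeff (α β : ℝ) (N : ℕ) : Module.End ℂ (Fock α) :=
  expCoeff (fun n : ℕ => ((β : ℂ) / (n : ℂ)) • oscillator α (-(n : ℤ))) N

/-- The coefficient of `z ^ (-N)` in `exp (-β ∑_{n > 0} (a_n / n) z ^ (-n))`. -/
def annihilationCoeff (α β : ℝ) (N : ℕ) : Module.End ℂ (Fock α) :=
  expCoeff (fun n : ℕ => (-(β : ℂ) / (n : ℂ)) • oscillator α (n : ℤ)) N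

/-- The level of the state `∏ (a_{-(j+1)}) ^ e_j |α⟩`. -/
def level (e : ℕ →₀ ℕ) : ℕ := Finsupp.weight (fun j : ℕ => j + 1) e

theorem list_prod_annihilation_eq_zero (α : ℝ) (c : ℕ → ℂ) (l : List ℕ) :
    (∀ i ∈ l, 0 < i) → ∀ (e : ℕ →₀ ℕ) (x : ℂ), level e < l.sum →
      (l.map fun n : ℕ => c n • oscillator α (n : ℤ)).prod (MvPolynomial.monomial e x) = 0 := by
  induction l using List.reverseRecOn with
  | nil => intro _ e x h; simp at h
  | append_singleton l n ih =>
    intro hpos e x h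
    have hn : 0 < n := hpos n (by simp)
    obtain ⟨j, rfl⟩ : ∃ j, n = j + 1 := ⟨n - 1, by omega⟩
    rw [List.map_append, List.prod_append]
    have hosc : oscillator α ((j + 1 : ℕ) : ℤ) =
      ((j + 1 : ℕ) : ℂ) • (MvPolynomial.pderiv (R := ℂ) j).toLinearMap := rfl
    simp only [List.map_cons, List.map_nil, List.prod_cons, List.prod_nil, mul_one,
      Module.End.mul_apply, LinearMap.smul_apply, hosc, Derivation.coeFn_coe,
      MvPolynomial.pderiv_monomial, map_smul]
    by_cases hj : e j = 0
    · simp [hj]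
    · have hlev : level (e - Finsupp.single j 1) + (j + 1) = level e := by
        have h1 : e = (e - Finsupp.single j 1) + Finsupp.single j 1 := by
          ext i
          by_cases hi : i = j
          · subst hi; simp; omega
          · simp [Ne.symm hi]
        conv_rhs => rw [h1]
        simp [level, Finsupp.weight_single]
      rw [ih (fun i hi => hpos i (by simp [hi]))]
      · simp
      · simp at h; omega

/-- On each vector only finitely many annihilation coefficients are nonzero. -/
theorem annihilationCoeff_locally_finite (α β : ℝ) (v : Fock α) :
    {N : ℕ | annihilationCoeff α β N v ≠ 0}.Finite := by
  suffices h : ∃ B : ℕ, ∀ N, B ≤ N → annihilationCoeff α β N v = 0 by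
    obtain ⟨B, hB⟩ := h
    refine (Set.finite_lt_nat B).subset fun N hN => ?_
    by_contra hc
    exact hN (hB N (not_lt.mp hc))
  induction v using MvPolynomial.induction_on' with
  | monomial e x =>
    refine ⟨level e + 1, fun N hN => ?_⟩
    simp only [annihilationCoeff, expCoeff, LinearMap.sum_apply, LinearMap.smul_apply]
    refine Finset.sum_eq_zero fun c _ => ?_
    rw [list_prod_annihilation_eq_zero α (fun n : ℕ => -(β : ℂ) / (n : ℂ)) c.blocks
      (fun i hi => c.blocks_pos hi) e x (by rw [c.blocks_sum]; omega), smul_zero]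
  | add p q hp hq =>
    obtain ⟨B, hB⟩ := hp
    obtain ⟨C, hC⟩ := hq
    refine ⟨max B C, fun N hN => ?_⟩
    rw [map_add, hB N (le_trans (le_max_left _ _) hN), hC N (le_trans (le_max_right _ _) hN),
      add_zero]

/-- The pairs `(M, N)` for which `z ^ M * z ^ (-N) * z ^ (β α) = z ^ x`. -/
def exponentPairs (α β x : ℝ) : Set (ℕ × ℕ) := {p | (p.1 : ℝ) - (p.2 : ℝ) + β * α = x}

theorem vertexCoeff_finite (α β x : ℝ) (v : Fock α) :
    (exponentPairs α β x ∩ Function.support (fun p : ℕ × ℕ =>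
      creationCoeff (α + β) β p.1 (annihilationCoeff α β p.2 v))).Finite := by
  refine Set.Finite.of_finite_image (f := Prod.snd) ?_ ?_
  · refine (annihilationCoeff_locally_finite α β v).subset ?_
    rintro _ ⟨p, ⟨-, hp⟩, rfl⟩ h0
    exact hp (by simp [h0])
  · rintro ⟨a, b⟩ ⟨hp, -⟩ ⟨c, d⟩ ⟨hq, -⟩ (rfl : b = d)
    simp only [exponentPairs, Set.mem_ofPred_eq] at hp hq
    have : (a : ℝ) = c := by linarith
    rw [Nat.cast_injective this]

/-- The coefficient of `z ^ x` in the normally ordered vertex operator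
`:e^{iβφ(z)}: = exp (β ∑_{n>0} (a_{-n}/n) z^n) exp (-β ∑_{n>0} (a_n/n) z^{-n}) e^{iβx̂} z^{β a_0}`
acting from `F_α` to `F_{α+β}`. The factor `e^{iβx̂}` maps a state of `F_α` to the state of
`F_{α+β}` given by the same polynomial. -/
def vertexCoeff (α β x : ℝ) : Fock α →ₗ[ℂ] Fock (α + β) where
  toFun v := ∑ᶠ p ∈ exponentPairs α β x,
    creationCoeff (α + β) β p.1 (annihilationCoeff α β p.2 v)
  map_add' v w := by
    simp only [map_add]
    exact finsum_mem_add_distrib' (vertexCoeff_finite α β x v) (vertexCoeff_finite α β x w)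
  map_smul' r v := by
    simp only [map_smul, RingHom.id_apply]
    exact ((DistribSMul.toAddMonoidHom (Fock (α + β)) r).map_finsum_mem'
      (vertexCoeff_finite α β x v)).symm

/-- The set of charges `α_{nm} = n √(2k) + m / √(2k)`, `n, m ∈ ℤ`. -/
def charges (k : ℕ) : Set ℝ :=
  {α | ∃ n m : ℤ, α = n * √(2 * k) + m / √(2 * k)}

/-- The chiral space `H`: the direct sum of one Fock module for each charge in the set. -/
def ChiralSpace (k : ℕ) : Type := DirectSum (charges k) (fun α => Fock α)

instance (k : ℕ) : AddCommGroup (ChiralSpace k) :=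
  inferInstanceAs (AddCommGroup (DirectSum (charges k) (fun α => Fock α)))

instance (k : ℕ) : Module ℂ (ChiralSpace k) :=
  inferInstanceAs (Module ℂ (DirectSum (charges k) (fun α => Fock α)))

/-- The inclusion of the summand `F_α` in `H`. -/
def fockInclusion (k : ℕ) (α : charges k) : Fock α →ₗ[ℂ] ChiralSpace k :=
  DirectSum.lof ℂ (charges k) (fun α => Fock α) α

/-- The operator on `H` that is given by `f α` on each summand `F_α`. -/
def assemble (k : ℕ) (f : ∀ α : charges k, Fock α →ₗ[ℂ] ChiralSpace k) :
    Module.End ℂ (ChiralSpace k) :=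
  DirectSum.toModule ℂ (charges k) (ChiralSpace k) f

/-- The charge `α + ε √(2k)`. -/
def shiftCharge (k : ℕ) (ε : ℤ) (α : charges k) : charges k :=
  ⟨α + ε * √(2 * k), by
    obtain ⟨_, n, m, rfl⟩ := α
    exact ⟨n + ε, m, by push_cast; ring⟩⟩

/-- The mode `J^0_n` of `J^0(z) = (1/√(2k)) i∂φ(z) = ∑_n J^0_n z^{-n-1}`. -/
def neutralCurrent (k : ℕ) (n : ℤ) : Module.End ℂ (ChiralSpace k) :=
  assemble k fun α =>
    fockInclusion k α ∘ₗ (((1 / √(2 * k) : ℝ) : ℂ) • oscillator α n)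

/-- For `ε = 1` and `ε = -1`, the modes `J^+_n` and `J^-_n` of
`J^±(z) = :e^{±i√(2k)φ(z)}: = ∑_n J^±_n z^{-n-k}`. -/
def chargedCurrent (k : ℕ) (ε : ℤ) (n : ℤ) : Module.End ℂ (ChiralSpace k) :=
  assemble k fun α =>
    fockInclusion k (shiftCharge k ε α) ∘ₗ vertexCoeff α (ε * √(2 * k)) (-n - k)

/-- The algebra of operators on `H` generated by all modes of `J^+`, `J^-` and `J^0`. -/
def currentAlgebra (k : ℕ) : Subalgebra ℂ (Module.End ℂ (ChiralSpace k)) :=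
  Algebra.adjoin ℂ (Set.range (chargedCurrent k 1) ∪ Set.range (chargedCurrent k (-1)) ∪
    Set.range (neutralCurrent k))

/-- The charge `m / √(2k) + n √(2k)`. -/
def sectorCharge (k : ℕ) (m n : ℤ) : charges k :=
  ⟨m / √(2 * k) + n * √(2 * k), n, m, add_comm _ _⟩

/-- The Fock module `F_α` as a subspace of `H`. -/
def fockSubspace (k : ℕ) (α : charges k) : Submodule ℂ (ChiralSpace k) :=
  LinearMap.range (fockInclusion k α)

/-- The subspace `𝓗_m = ∑_{n ∈ ℤ} F_{m/√(2k) + n√(2k)}` of `H`. -/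
def sector (k : ℕ) (m : ℤ) : Submodule ℂ (ChiralSpace k) :=
  ⨆ n : ℤ, fockSubspace k (sectorCharge k m n)

end TorusModel

end

noncomputable section

namespace TorusModel

open MvPolynomial

/-! The charges in Λ are the numbers N/√(2k) with N an integer. J^0 preserves N and J^± shift it by
±2k, so the classes of N mod 2k split H into the invariant subspaces 𝓗_m.

For irreducibility, let W be a nonzero submodule of 𝓗_m. J^0_0 acts on F_α as the scalar α/√(2k),
which separates charges, so polynomials in J^0_0 isolate a nonzero state of W in a single F_α
(`exists_mem_fockPart_ne_zero`). The annihilation modes are derivatives up to scalars and lower it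
to |α⟩ (`one_mem_fockPart`). The leading modes of J^± send |α⟩ exactly to |α ± √(2k)⟩
(`vertexCoeff_one`), so W contains every highest weight vector of the sector, and the creation modes
then fill each Fock module. No commutation relations of the charged currents are needed. -/

/-- A nonzero polynomial over a field of characteristic zero yields `1` by taking partial
derivatives and multiplying by scalars. -/
theorem one_mem_of_pderiv_mem {σ K : Type*} [Field K] [CharZero K]
    (U : Submodule K (MvPolynomial σ K))
    (hU : ∀ i, ∀ p ∈ U, pderiv i p ∈ U) {p : MvPolynomial σ K} (hp : p ∈ U) (h0 : p ≠ 0) :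
    1 ∈ U := by
  suffices H : ∀ n : ℕ, ∀ p ∈ U, p ≠ 0 → p.totalDegree ≤ n → 1 ∈ U from H _ p hp h0 le_rfl
  intro n
  induction n with
  | zero =>
    intro p hp h0 hn
    have hC := totalDegree_eq_zero_iff_eq_C.mp (Nat.le_zero.mp hn)
    have hc : coeff 0 p ≠ 0 := fun h => h0 (by rw [hC, h, C_0])
    have h1 : (coeff 0 p)⁻¹ • p = 1 := by
      conv_lhs => rw [hC]
      simp [smul_eq_C_mul, ← C_mul, hc]
    exact h1 ▸ U.smul_mem _ hp
  | succ n ih =>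
    intro p hp h0 hn
    by_cases hd : p.totalDegree ≤ n
    · exact ih p hp h0 hd
    obtain ⟨e, he, i, hi⟩ : ∃ e ∈ p.support, ∃ i, e i ≠ 0 := by
      by_contra! hc
      refine hd (le_trans (Finset.sup_le fun e he => ?_) (Nat.zero_le n))
      have : e = 0 := Finsupp.ext (hc e he)
      simp [this]
    have hsub : e - Finsupp.single i 1 + Finsupp.single i 1 = e :=
      tsub_add_cancel_of_le (Finsupp.single_le_iff.mpr (Nat.one_le_iff_ne_zero.mpr hi))
    refine ih _ (hU i p hp) (fun hz => ?_) (Finset.sup_le fun m hm => ?_)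
    -- The coefficient of ∂_i p at e - δ_i is e_i times that of p at e, nonzero in characteristic
    -- zero.
    · have h1 : coeff (e - Finsupp.single i 1) (pderiv i p) = 0 := by rw [hz, coeff_zero]
      rw [coeff_pderiv, hsub] at h1
      rcases mul_eq_zero.mp h1 with h | h
      · exact mem_support_iff.mp he h
      · exact Nat.cast_add_one_ne_zero _ h
    · rw [mem_support_iff, coeff_pderiv] at hm
      have h1 := le_totalDegree (mem_support_iff.mpr (left_ne_zero_of_mul hm))
      rw [Finsupp.sum_add_index' (fun _ => rfl) (fun _ _ _ => rfl),
        Finsupp.sum_single_index rfl] at h1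
      omega

/-- A subspace that contains `1` and is stable under multiplication by the variables contains
every polynomial. -/
theorem eq_top_of_one_mem_of_X_mul_mem {σ R : Type*} [CommSemiring R]
    (U : Submodule R (MvPolynomial σ R))
    (hU : ∀ i, ∀ p ∈ U, X i * p ∈ U) (h1 : 1 ∈ U) : U = ⊤ := by
  refine eq_top_iff.mpr fun p _ => ?_
  induction p using MvPolynomial.induction_on with
  | C a => simpa [smul_eq_C_mul] using U.smul_mem a h1
  | add p q hp hq => exact U.add_mem (hp trivial) (hq trivial)
  | mul_X p i hp => exact mul_comm p (X i) ▸ hU i p (hp trivial)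

/-! ### Vertex operators on highest weight vectors -/

theorem expCoeff_zero {A : Type*} [Ring A] [Algebra ℂ A] (t : ℕ → A) : expCoeff t 0 = 1 := by
  have h (c : Composition 0) : c.blocks = [] :=
    List.eq_nil_of_length_eq_zero (Nat.le_zero.mp c.length_le)
  simp [expCoeff, h, Composition.length, composition_card]

theorem annihilationCoeff_one (α β : ℝ) {N : ℕ} (hN : N ≠ 0) :
    annihilationCoeff α β N 1 = 0 := by
  simp only [annihilationCoeff, expCoeff, LinearMap.sum_apply, LinearMap.smul_apply]
  refine Finset.sum_eq_zero fun c _ => ?_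
  rw [show (1 : Fock α) = monomial 0 1 from rfl,
    list_prod_annihilation_eq_zero α (fun n : ℕ => -(β : ℂ) / (n : ℂ)) c.blocks
      (fun i hi => c.blocks_pos hi) 0 1 (by simpa [level, c.blocks_sum] using Nat.pos_of_ne_zero hN),
    smul_zero]

/-- The leading coefficient of the vertex operator maps `|α⟩` to `|α + β⟩`. -/
theorem vertexCoeff_one (α β : ℝ) : vertexCoeff α β (β * α) 1 = 1 := by
  change ∑ᶠ p ∈ exponentPairs α β (β * α),
    creationCoeff (α + β) β p.1 (annihilationCoeff α β p.2 1) = 1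
  -- Annihilation terms with N > 0 kill `1`; for N = 0 the exponent condition forces M = 0.
  rw [finsum_mem_inter_support_eq _ _ {(0, 0)}]
  · rw [finsum_mem_singleton]
    simp [creationCoeff, annihilationCoeff, expCoeff_zero]
  · ext ⟨M, N⟩
    simp only [exponentPairs, Set.mem_inter_iff, Set.mem_ofPred_eq, Function.mem_support,
      Set.mem_singleton_iff, Prod.mk.injEq]
    refine and_congr_left fun hne => ?_
    have hN : N = 0 := by
      by_contra hN
      exact hne (by rw [annihilationCoeff_one α β hN, map_zero])
    subst hN
    simp

/-! ### Arithmetic of the charges -/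

theorem charges_pos_sqrt {k : ℕ} (hk : 0 < k) : 0 < √(2 * k : ℝ) := by positivity

/-- Over the common denominator √(2k), comparing charges becomes comparing integers. -/
theorem sectorCharge_val {k : ℕ} (hk : 0 < k) (m n : ℤ) :
    (sectorCharge k m n : ℝ) = ((m + 2 * k * n : ℤ) : ℝ) / √(2 * k) := by
  have h := charges_pos_sqrt hk
  have h2 : √(2 * k : ℝ) * √(2 * k) = 2 * k := Real.mul_self_sqrt (by positivity)
  change (m : ℝ) / √(2 * k) + n * √(2 * k) = _
  field_simp
  push_cast
  linear_combination (n : ℝ) * h2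

theorem sectorCharge_eq_iff {k : ℕ} (hk : 0 < k) {m n m' n' : ℤ} :
    sectorCharge k m n = sectorCharge k m' n' ↔ m + 2 * k * n = m' + 2 * k * n' := by
  rw [← Subtype.coe_inj, sectorCharge_val hk, sectorCharge_val hk,
    div_left_inj' (charges_pos_sqrt hk).ne', Int.cast_inj]

theorem sectorCharge_injective {k : ℕ} (hk : 0 < k) (m : ℤ) :
    Function.Injective (sectorCharge k m) := fun n n' h => by
  rw [sectorCharge_eq_iff hk] at h
  have : (2 * k : ℤ) ≠ 0 := by positivity
  exact mul_left_cancel₀ this (by linarith)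

theorem exists_sectorCharge {k : ℕ} (hk : 0 < k) (α : charges k) :
    ∃ (m : Fin (2 * k)) (n : ℤ), α = sectorCharge k (m : ℕ) n := by
  obtain ⟨_, n, m, rfl⟩ := α
  have hk' : (0 : ℤ) < 2 * k := by positivity
  have h0 := Int.emod_nonneg m hk'.ne'
  have h1 := Int.emod_lt_of_pos m hk'
  -- Since 2k/√(2k) = √(2k), the quotient of m by 2k is absorbed into n.
  refine ⟨⟨(m % (2 * k)).toNat, by omega⟩, n + m / (2 * k), ?_⟩
  trans sectorCharge k m n
  · exact Subtype.ext (add_comm _ _)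
  · rw [sectorCharge_eq_iff hk]
    have := Int.emod_add_mul_ediv m (2 * k)
    simp only [Int.toNat_of_nonneg h0]
    linear_combination -this

theorem shiftCharge_sectorCharge (k : ℕ) (ε m n : ℤ) :
    shiftCharge k ε (sectorCharge k m n) = sectorCharge k m (n + ε) := by
  refine Subtype.ext ?_
  change (m : ℝ) / √(2 * k) + n * √(2 * k) + ε * √(2 * k) = m / √(2 * k) + (n + ε : ℤ) * √(2 * k)
  push_cast
  ring

/-! ### Decomposition of H into Fock modules and sectors -/

/-- The component of a vector of `H` in the summand `F_α`. -/
def fockComponent (k : ℕ) (α : charges k) : ChiralSpace k →ₗ[ℂ] Fock α :=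
  DirectSum.component ℂ (charges k) (fun α => Fock α) α

theorem fockComponent_fockInclusion (k : ℕ) (α : charges k) (p : Fock α) :
    fockComponent k α (fockInclusion k α p) = p :=
  DirectSum.component.lof_self ℂ _ _

theorem fockComponent_fockInclusion_of_ne (k : ℕ) {α β : charges k} (h : β ≠ α) (p : Fock β) :
    fockComponent k α (fockInclusion k β p) = 0 :=
  (DirectSum.component.of ℂ _ _ _).trans (dif_neg h)

theorem exists_sum_fockInclusion (k : ℕ) (v : ChiralSpace k) :
    ∃ s : Finset (charges k), v = ∑ α ∈ s, fockInclusion k α (fockComponent k α v) := by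
  classical
  exact ⟨_, (DirectSum.sum_support_of (β := fun α : charges k => Fock α) v).symm⟩

theorem assemble_fockInclusion (k : ℕ) (f : ∀ α : charges k, Fock α →ₗ[ℂ] ChiralSpace k)
    (α : charges k) (p : Fock α) : assemble k f (fockInclusion k α p) = f α p :=
  DirectSum.toModule_lof ℂ _ _

theorem fockSubspace_le_ker (k : ℕ) {α β : charges k} (h : β ≠ α) :
    fockSubspace k β ≤ LinearMap.ker (fockComponent k α) := by
  rintro _ ⟨p, rfl⟩
  exact fockComponent_fockInclusion_of_ne k h p

theorem iSupIndep_fockSubspace (k : ℕ) : iSupIndep (fockSubspace k) := by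
  intro α
  refine Disjoint.mono_right (iSup₂_le fun β hβ => fockSubspace_le_ker k hβ) ?_
  rw [Submodule.disjoint_def]
  rintro _ ⟨p, rfl⟩ hp
  rw [LinearMap.mem_ker, fockComponent_fockInclusion] at hp
  rw [hp, map_zero]

theorem iSup_fockSubspace (k : ℕ) : ⨆ α, fockSubspace k α = ⊤ := by
  refine eq_top_iff.mpr fun v _ => ?_
  obtain ⟨s, hs⟩ := exists_sum_fockInclusion k v
  rw [hs]
  exact Submodule.sum_mem _ fun α _ => Submodule.mem_iSup_of_mem α ⟨_, rfl⟩

theorem sector_eq_biSup (k : ℕ) (m : ℤ) :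
    sector k m = ⨆ α ∈ Set.range (sectorCharge k m), fockSubspace k α :=
  iSup_range.symm

theorem isInternal_sector {k : ℕ} (hk : 0 < k) :
    DirectSum.IsInternal (fun m : Fin (2 * k) => sector k (m : ℕ)) := by
  rw [DirectSum.isInternal_submodule_iff_iSupIndep_and_iSup_eq_top]
  constructor
  · intro m
    have hdisj : Disjoint (Set.range (sectorCharge k (m : ℕ)))
        (⋃ m' : Fin (2 * k), ⋃ _ : m' ≠ m, Set.range (sectorCharge k (m' : ℕ))) := by
      rw [Set.disjoint_left]
      rintro _ ⟨n, rfl⟩ h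
      simp only [Set.mem_iUnion, Set.mem_range] at h
      obtain ⟨m', hne, n', h⟩ := h
      rw [sectorCharge_eq_iff hk] at h
      have := congrArg (· % (2 * k : ℤ)) h
      simp only [Int.add_mul_emod_self_left] at this
      refine hne (Fin.ext ?_)
      have h1 := m.isLt
      have h2 := m'.isLt
      rw [Int.emod_eq_of_lt (by omega) (by omega), Int.emod_eq_of_lt (by omega) (by omega)] at this
      exact_mod_cast this
    refine ((iSupIndep_fockSubspace k).disjoint_biSup_biSup hdisj).mono
      (sector_eq_biSup k _).le (iSup₂_le fun m' hne => ?_)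
    refine (sector_eq_biSup k _).le.trans ?_
    refine biSup_mono fun α hα => ?_
    exact Set.mem_iUnion₂.mpr ⟨m', hne, hα⟩
  · refine eq_top_iff.mpr ((iSup_fockSubspace k).ge.trans (iSup_le fun α => ?_))
    obtain ⟨m, n, rfl⟩ := exists_sectorCharge hk α
    exact (le_iSup (fun n => fockSubspace k (sectorCharge k (m : ℕ) n)) n).trans
      (le_iSup (fun m : Fin (2 * k) => sector k (m : ℕ)) m)

/-! ### Invariance of the sectors under the currents -/

theorem neutralCurrent_fockInclusion (k : ℕ) (n : ℤ) (α : charges k) (p : Fock α) :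
    neutralCurrent k n (fockInclusion k α p) =
      ((1 / √(2 * k) : ℝ) : ℂ) • fockInclusion k α (oscillator α n p) := by
  rw [neutralCurrent, assemble_fockInclusion, LinearMap.comp_apply, LinearMap.smul_apply, map_smul]

theorem chargedCurrent_fockInclusion (k : ℕ) (ε n : ℤ) (α : charges k) (p : Fock α) :
    chargedCurrent k ε n (fockInclusion k α p) =
      fockInclusion k (shiftCharge k ε α) (vertexCoeff α (ε * √(2 * k)) (-n - k) p) :=
  assemble_fockInclusion _ _ _ _

theorem neutralCurrent_mem (k : ℕ) (n : ℤ) : neutralCurrent k n ∈ currentAlgebra k :=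
  Algebra.subset_adjoin (Or.inr ⟨n, rfl⟩)

theorem chargedCurrent_one_mem (k : ℕ) (n : ℤ) : chargedCurrent k 1 n ∈ currentAlgebra k :=
  Algebra.subset_adjoin (Or.inl (Or.inl ⟨n, rfl⟩))

theorem chargedCurrent_neg_one_mem (k : ℕ) (n : ℤ) : chargedCurrent k (-1) n ∈ currentAlgebra k :=
  Algebra.subset_adjoin (Or.inl (Or.inr ⟨n, rfl⟩))

theorem neutralCurrent_mem_sector (k : ℕ) (m n : ℤ) {v : ChiralSpace k} (hv : v ∈ sector k m) :
    neutralCurrent k n v ∈ sector k m := by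
  suffices h : sector k m ≤ (sector k m).comap (neutralCurrent k n) from h hv
  refine iSup_le fun j => ?_
  rintro _ ⟨p, rfl⟩
  rw [Submodule.mem_comap, neutralCurrent_fockInclusion]
  exact Submodule.smul_mem _ _ (Submodule.mem_iSup_of_mem j ⟨_, rfl⟩)

theorem chargedCurrent_mem_sector (k : ℕ) (m ε n : ℤ) {v : ChiralSpace k} (hv : v ∈ sector k m) :
    chargedCurrent k ε n v ∈ sector k m := by
  suffices h : sector k m ≤ (sector k m).comap (chargedCurrent k ε n) from h hv
  refine iSup_le fun j => ?_
  rintro _ ⟨p, rfl⟩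
  rw [Submodule.mem_comap, chargedCurrent_fockInclusion]
  refine Submodule.mem_iSup_of_mem (j + ε) ?_
  rw [← shiftCharge_sectorCharge]
  exact ⟨_, rfl⟩

theorem currentAlgebra_apply_mem_sector (k : ℕ) (m : ℤ) {T : Module.End ℂ (ChiralSpace k)}
    (hT : T ∈ currentAlgebra k) {v : ChiralSpace k} (hv : v ∈ sector k m) : T v ∈ sector k m := by
  induction hT using Algebra.adjoin_induction generalizing v with
  | mem T hT =>
    rcases hT with (⟨n, rfl⟩ | ⟨n, rfl⟩) | ⟨n, rfl⟩
    · exact chargedCurrent_mem_sector k m 1 n hv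
    · exact chargedCurrent_mem_sector k m (-1) n hv
    · exact neutralCurrent_mem_sector k m n hv
  | algebraMap c => exact Submodule.smul_mem _ c hv
  | add S T _ _ hS hT => exact Submodule.add_mem _ (hS hv) (hT hv)
  | mul S T _ _ hS hT => exact hS (hT hv)

/-- The space `𝓗_m` as a submodule over the algebra of the currents. -/
def sectorSubmodule (k : ℕ) (m : ℤ) : Submodule (currentAlgebra k) (ChiralSpace k) where
  __ := sector k m
  smul_mem' T _ hv := currentAlgebra_apply_mem_sector k m T.2 hv

/-! ### Irreducibility of the sectors -/

section Submodules

variable {k : ℕ} (W : Submodule (currentAlgebra k) (ChiralSpace k))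

/-- The states of `F_α` that lie in a given submodule of `H`. -/
def fockPart (α : charges k) : Submodule ℂ (Fock α) :=
  (W.restrictScalars ℂ).comap (fockInclusion k α)

variable {W}

theorem apply_mem_of_mem_currentAlgebra {T : Module.End ℂ (ChiralSpace k)}
    (hT : T ∈ currentAlgebra k) {v : ChiralSpace k} (hv : v ∈ W) : T v ∈ W :=
  W.smul_mem (⟨T, hT⟩ : currentAlgebra k) hv

theorem oscillator_mem_fockPart (hk : 0 < k) {α : charges k} {p : Fock α} (hp : p ∈ fockPart W α)
    (n : ℤ) : oscillator α n p ∈ fockPart W α := by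
  have h : neutralCurrent k n (fockInclusion k α p) ∈ W.restrictScalars ℂ :=
    apply_mem_of_mem_currentAlgebra (neutralCurrent_mem k n) hp
  rw [neutralCurrent_fockInclusion] at h
  refine ((W.restrictScalars ℂ).smul_mem_iff ?_).mp h
  exact_mod_cast (one_div_pos.mpr (charges_pos_sqrt hk)).ne'

theorem fockPart_eq_top_of_one_mem (hk : 0 < k) {α : charges k} (h1 : 1 ∈ fockPart W α) :
    fockPart W α = ⊤ :=
  eq_top_of_one_mem_of_X_mul_mem _
    (fun j _ hp => oscillator_mem_fockPart hk hp (Int.negSucc j)) h1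

theorem one_mem_fockPart (hk : 0 < k) {α : charges k} {p : Fock α} (hp : p ∈ fockPart W α)
    (h0 : p ≠ 0) : 1 ∈ fockPart W α := by
  refine one_mem_of_pderiv_mem _ (fun j q hq => ?_) hp h0
  have h : ((j + 1 : ℕ) : ℂ) • pderiv j q ∈ fockPart W α :=
    oscillator_mem_fockPart hk hq (Int.ofNat (j + 1))
  exact ((fockPart W α).smul_mem_iff (Nat.cast_ne_zero.mpr j.succ_ne_zero)).mp h

theorem one_mem_fockPart_shift (hk : 0 < k) {ε : ℤ}
    (hε : ∀ n, chargedCurrent k ε n ∈ currentAlgebra k) {m j : ℤ}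
    (h : 1 ∈ fockPart W (sectorCharge k m j)) : 1 ∈ fockPart W (sectorCharge k m (j + ε)) := by
  -- The mode index n solves -n - k = βα with β = ε√(2k), the leading exponent on |α⟩; it is an
  -- integer because βα = ε(m + 2kj).
  have h2 := apply_mem_of_mem_currentAlgebra (hε (-k - ε * (m + 2 * k * j))) h
  rw [chargedCurrent_fockInclusion] at h2
  have hx : (-((-k - ε * (m + 2 * k * j) : ℤ) : ℝ) - k) =
      ε * √(2 * k) * (sectorCharge k m j : ℝ) := by
    have := charges_pos_sqrt hk
    rw [sectorCharge_val hk]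
    field_simp
    push_cast
    ring
  rw [hx, vertexCoeff_one] at h2
  rw [← shiftCharge_sectorCharge]
  exact h2

theorem one_mem_fockPart_sectorCharge (hk : 0 < k) {m j : ℤ}
    (h : 1 ∈ fockPart W (sectorCharge k m j)) (n : ℤ) :
    1 ∈ fockPart W (sectorCharge k m n) := by
  induction n using Int.inductionOn' (b := j) with
  | zero => exact h
  | succ n _ ih => exact one_mem_fockPart_shift hk (chargedCurrent_one_mem k) ih
  | pred n _ ih => exact one_mem_fockPart_shift hk (chargedCurrent_neg_one_mem k) ih

theorem aeval_neutralCurrent_fockInclusion (f : Polynomial ℂ) (α : charges k) (p : Fock α) :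
    Polynomial.aeval (neutralCurrent k 0) f (fockInclusion k α p) =
      f.eval (((1 / √(2 * k) : ℝ) : ℂ) * ((α : ℝ) : ℂ)) • fockInclusion k α p := by
  have h0 : neutralCurrent k 0 (fockInclusion k α p) =
      (((1 / √(2 * k) : ℝ) : ℂ) * ((α : ℝ) : ℂ)) • fockInclusion k α p := by
    rw [neutralCurrent_fockInclusion, mul_smul]
    exact congrArg _ (map_smul (fockInclusion k α) ((α : ℝ) : ℂ) p)
  by_cases hp : fockInclusion k α p = 0
  -- Eigenvectors must be nonzero, hence the separate case.
  · rw [hp, map_zero, smul_zero]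
  · exact Module.End.aeval_apply_of_hasEigenvector
      ⟨Module.End.mem_eigenspace_iff.mpr h0, hp⟩

theorem exists_mem_fockPart_ne_zero (hk : 0 < k) {v : ChiralSpace k} (hv : v ∈ W) (h0 : v ≠ 0) :
    ∃ (α : charges k) (p : Fock α), p ∈ fockPart W α ∧ p ≠ 0 := by
  classical
  obtain ⟨s, hs⟩ := exists_sum_fockInclusion k v
  obtain ⟨α, hα, hne⟩ : ∃ α ∈ s, fockInclusion k α (fockComponent k α v) ≠ 0 := by
    by_contra! h
    exact h0 (hs.trans (Finset.sum_eq_zero h))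
  refine ⟨α, fockComponent k α v, ?_, fun h => hne (by rw [h, map_zero])⟩
  let c : charges k → ℂ := fun β => ((1 / √(2 * k) : ℝ) : ℂ) * ((β : ℝ) : ℂ)
  have hc : Function.Injective c := fun β γ h => by
    have h1 : ((1 / √(2 * k) : ℝ) : ℂ) ≠ 0 := by
      exact_mod_cast (one_div_pos.mpr (charges_pos_sqrt hk)).ne'
    exact Subtype.ext (Complex.ofReal_injective (mul_left_cancel₀ h1 h))
  -- The Lagrange polynomial is 1 at the eigenvalue of α and 0 at those of the other charges in `s`,
  -- so it projects `v` onto its component in F_α.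
  have hT : Polynomial.aeval (neutralCurrent k 0) (Lagrange.basis s c α) ∈ currentAlgebra k :=
    Algebra.adjoin_le (Set.singleton_subset_iff.mpr (neutralCurrent_mem k 0))
      (Polynomial.aeval_mem_adjoin_singleton ℂ _)
  have hmem := apply_mem_of_mem_currentAlgebra hT hv
  rw [hs, map_sum, Finset.sum_eq_single_of_mem α hα, aeval_neutralCurrent_fockInclusion] at hmem
  · have := Lagrange.eval_basis_self (v := c) hc.injOn hα
    rw [this, one_smul] at hmem
    exact hmem
  · intro β hβ hne
    have := Lagrange.eval_basis_of_ne (v := c) hne.symm hβ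
    rw [aeval_neutralCurrent_fockInclusion, this, zero_smul]

theorem exists_sectorCharge_of_fockInclusion_mem {α : charges k} {p : Fock α} (h0 : p ≠ 0) {m : ℤ}
    (h : fockInclusion k α p ∈ sector k m) : ∃ n, α = sectorCharge k m n := by
  by_contra! hne
  have h1 := (iSup_le fun n => fockSubspace_le_ker k (hne n).symm : sector k m ≤ _) h
  rw [LinearMap.mem_ker, fockComponent_fockInclusion] at h1
  exact h0 h1

theorem sectorSubmodule_le (hk : 0 < k) {m : ℤ} (hW : W ≤ sectorSubmodule k m) (h0 : W ≠ ⊥) :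
    sectorSubmodule k m ≤ W := by
  obtain ⟨v, hv, hv0⟩ := W.ne_bot_iff.mp h0
  obtain ⟨α, p, hp, hp0⟩ := exists_mem_fockPart_ne_zero hk hv hv0
  obtain ⟨j, rfl⟩ := exists_sectorCharge_of_fockInclusion_mem hp0 (hW hp)
  suffices h : sector k m ≤ W.restrictScalars ℂ from h
  refine iSup_le fun n => ?_
  rintro _ ⟨q, rfl⟩
  have htop := fockPart_eq_top_of_one_mem hk
    (one_mem_fockPart_sectorCharge hk (one_mem_fockPart hk hp hp0) n)
  exact (htop ▸ Submodule.mem_top : q ∈ fockPart W (sectorCharge k m n))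

end Submodules

theorem isSimpleModule_sectorSubmodule {k : ℕ} (hk : 0 < k) (m : ℤ) :
    IsSimpleModule (currentAlgebra k) (sectorSubmodule k m) := by
  refine isSimpleModule_iff_isAtom.mpr ⟨?_, fun W hW => ?_⟩
  · refine (Submodule.ne_bot_iff _).mpr ⟨fockInclusion k (sectorCharge k m 0) 1,
      Submodule.mem_iSup_of_mem (0 : ℤ) ⟨1, rfl⟩, fun h => ?_⟩
    have h1 := congrArg (fockComponent k (sectorCharge k m 0)) h
    rw [fockComponent_fockInclusion, map_zero] at h1
    exact one_ne_zero h1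
  · by_contra h0
    exact hW.not_ge (sectorSubmodule_le hk hW.le h0)

end TorusModel

end

theorem mainTheorem1 (k : ℕ) (hk : 0 < k) :
    DirectSum.IsInternal (fun m : Fin (2 * k) => TorusModel.sector k (m : ℕ)) ∧
    ∀ m : Fin (2 * k),
      iSupIndep (fun n : ℤ =>
        TorusModel.fockSubspace k (TorusModel.sectorCharge k (m : ℕ) n)) ∧
      ∃ N : Submodule (TorusModel.currentAlgebra k) (TorusModel.ChiralSpace k),
        N.restrictScalars ℂ = TorusModel.sector k (m : ℕ) ∧
        IsSimpleModule (TorusModel.currentAlgebra k) N :=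
  ⟨TorusModel.isInternal_sector hk, fun m =>
    ⟨(TorusModel.iSupIndep_fockSubspace k).comp (TorusModel.sectorCharge_injective hk _),
      TorusModel.sectorSubmodule k (m : ℕ), rfl, TorusModel.isSimpleModule_sectorSubmodule hk _⟩⟩
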